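/- Rings are commutative with $1$. Let $R\subseteq S$ be a ring extension, and let $[R,S]$ denote the set of all $R$-subalgebras of $S$, ordered by inclusion. For $V\in[R,S]$, the extension $R\subseteq V$ is called \emph{strongly local} (SL) if $\mathrm U(R)=\mathrm U(V)$, where $\mathrm U$ denotes the group of units; \emph{seminormal} if every $b\in V$ with $b^2,b^3\in R$ lies in $R$; and \emph{infra-integral} if $V$ is integral over $R$ and for every prime ideal $Q$ of $V$ the residual field extension $\kappa_R(Q\cap R)\to\kappa_V(Q)$ is an isomorphism. $\mathrm{MSupp}(V/R)$ is the set of maximal ideals $M$ of $R$ such that $(V/R)_M\neq 0$. The compositum of a family of elements of $[R,S]$ is the $R$-subalgebra of $S$ generated by the union of the family. \textbf{Theorem.} Assume that $R\subseteq S$ has FCP, that is, every chain in $[R,S]$ is finite, and that $S$ is semilocal, that is, has only finitely many maximal ideals. Then there exists a greatest $T\in[R,S]$ such that $R\subseteq T$ is strongly local. Moreover, let $$\mathcal F_1=\{V\in[R,S]\mid R\subseteq V \text{ is SL}\}$$ and $$\mathcal F_2=\{V\in[R,S]\mid R\subseteq V\text{ is seminormal and infra-integral, and } R/M\cong\mathbb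 Z/2\mathbb Z \text{ for every } M\in\mathrm{MSupp}(V/R)\}.$$ Then, for each $i\in\{1,2\}$, $T$ is the compositum of $\mathcal F_i$, the supremum of $\mathcal F_i$ in $[R,S]$, and the union of $\mathcal F_i$. -/

import Mathlib

section ExtensionNotions

/-- The extension `R ⊆ S` has FCP: every chain in the set `[R, S]` of all intermediate rings,
i.e. of all `R`-subalgebras of `S` ordered by inclusion, is finite. -/
def IsFCPExtension (R S : Type*) [CommRing R] [CommRing S] [Algebra R S] : Prop :=
  ∀ C : Set (Subalgebra R S), IsChain (· ≤ ·) C → C.Finite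

/-- A semilocal ring: there are only finitely many maximal ideals. -/
def IsSemilocal (S : Type*) [CommRing S] : Prop :=
  {M : Ideal S | M.IsMaximal}.Finite

/-- The extension `R ⊆ S` is strongly local (SL): `U(R) = U(S)`, where the unit group of `R` is
viewed inside `S`. -/
def IsStronglyLocal (R S : Type*) [CommRing R] [CommRing S] [Algebra R S] : Prop :=
  algebraMap R S '' {r | IsUnit r} = {s | IsUnit s}

/-- The extension `R ⊆ S` is seminormal (s-closed): an element `b` of `S` lies in `R` whenever
`b ^ 2` and `b ^ 3` lie in `R`. -/
def IsSeminormalExtension (R S : Type*) [CommRing R] [CommRing S] [Algebra R S] : Prop :=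
  ∀ b : S, b ^ 2 ∈ (algebraMap R S).range → b ^ 3 ∈ (algebraMap R S).range →
    b ∈ (algebraMap R S).range

/-- The extension `R ⊆ S` is infra-integral: it is integral, and for every prime ideal `Q` of `S`
the residual field extension `κ_R(Q ∩ R) → κ_S(Q)` is an isomorphism. -/
def IsInfraIntegral (R S : Type*) [CommRing R] [CommRing S] [Algebra R S] : Prop :=
  Algebra.IsIntegral R S ∧
    ∀ (Q : Ideal S) [Q.IsPrime],
      Function.Bijective
        (Ideal.ResidueField.map (Q.comap (algebraMap R S)) Q (algebraMap R S) rfl)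

/-- `MSupp(S/R)`: the maximal ideals of `R` that belong to the support of the `R`-module `S/R`. -/
def maximalSupport (R S : Type*) [CommRing R] [CommRing S] [Algebra R S] :
    Set (PrimeSpectrum R) :=
  {p | p ∈ Module.support R (S ⧸ LinearMap.range (Algebra.linearMap R S)) ∧ p.asIdeal.IsMaximal}

/-- The set of all `V ∈ [R, S]` such that `R ⊆ V` is strongly local. -/
def slSubextensions (R S : Type*) [CommRing R] [CommRing S] [Algebra R S] :
    Set (Subalgebra R S) :=
  {V | IsStronglyLocal R V}

/-- The set of all `V ∈ [R, S]` such that `R ⊆ V` is seminormal and infra-integral and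
`R/M ≅ ℤ/2ℤ` for all `M ∈ MSupp(V/R)`. -/
def seminormalInfraIntegralSubextensions (R S : Type*) [CommRing R] [CommRing S] [Algebra R S] :
    Set (Subalgebra R S) :=
  {V | IsSeminormalExtension R V ∧ IsInfraIntegral R V ∧
    ∀ p ∈ maximalSupport R V, Nonempty ((R ⧸ p.asIdeal) ≃+* ZMod 2)}

/-- The compositum of a family of intermediate rings: the subring of `S` generated by `R` and all
members of the family. -/
def compositum {R S : Type*} [CommRing R] [CommRing S] [Algebra R S]
    (F : Set (Subalgebra R S)) : Subalgebra R S :=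
  Algebra.adjoin R (⋃ V ∈ F, (V : Set S))

end ExtensionNotions

/-!
The theorem rests on one condition on an extension `R ⊆ V`: it is *Boolean modulo its conductor* if
`(v ^ 2 - v) * w ∈ R` for all `v`, `w` in `V` (`IsBooleanModConductor`). Every intermediate ring of
an FCP extension with semilocal top is semilocal, and for such `V` the following are equivalent:
`V` is strongly local over `R`; `V` is Boolean modulo its conductor; `V` belongs to the second
family of the theorem. Hence the two families coincide.

* If `V` is semilocal and strongly local over `R`, its Jacobson radical `J` lies in `R`, and the
  image of `R` in the product of fields `V / J` contains all units. Modulo `J`, each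
  `(v ^ 2 - v) * w` is a product of a unit and a difference of two units
  (`IsStronglyLocal.isBooleanModConductor`).
  Conversely `u - 1 = (u ^ 2 - u) * u⁻¹` for a unit `u`.
* The Boolean condition gives seminormality, infra-integrality and the residue fields `ℤ/2ℤ` at once.
  Conversely, under the conditions defining the second family, a unit `u` is congruent to `1` modulo
  every prime over a maximal ideal `M` in the support of `V / R`. By FCP and Nakayama's lemma high
  powers of `u - 1` lie in `R` locally at `M`, and seminormality brings `u - 1` itself into `R_M`
  (`IsSeminormalExtension.isStronglyLocal`).
* The Boolean condition passes to the compositum of two intermediate rings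
  (`IsBooleanModConductor.sup`): the intersection of the two conductors is an ideal of the
  compositum, modulo which everything is generated by idempotents in characteristic two. A maximal
  element, which exists by FCP, is therefore a greatest one.
* Semilocality descends from `S` along a finite chain of minimal extensions `A ⊆ B`: such an
  extension is trivial locally at all maximal ideals of `A` but one
  (`eq_of_localizedBot_ne_top`), and a maximal ideal at which it is trivial is contracted from a
  maximal ideal of `B`.
-/

/-! ### The Boolean condition -/

/-- The extension `R ⊆ B` is Boolean modulo its conductor: `(v ^ 2 - v) * w` lies in `R` for all
`v`, `w` in `B`. In other words, every element of `B` becomes idempotent modulo the conductor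
`(R : B)`, the largest ideal of `B` that is contained in `R`. -/
def IsBooleanModConductor (R B : Type*) [CommRing R] [CommRing B] [Algebra R B] : Prop :=
  ∀ v w : B, (v ^ 2 - v) * w ∈ (algebraMap R B).range

section Boolean

variable {R B : Type*} [CommRing R] [CommRing B] [Algebra R B]

theorem isStronglyLocal_of_forall_isUnit (hinj : Function.Injective (algebraMap R B))
    (h : ∀ u : B, IsUnit u → u ∈ (algebraMap R B).range) : IsStronglyLocal R B := by
  apply Set.Subset.antisymm
  · rintro _ ⟨r, hr, rfl⟩
    exact hr.map (algebraMap R B)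
  · rintro u hu
    obtain ⟨v, huv⟩ := isUnit_iff_exists_inv.mp hu
    obtain ⟨r, rfl⟩ := h u hu
    obtain ⟨s, rfl⟩ := h v (IsUnit.of_mul_eq_one _ (by rw [mul_comm]; exact huv))
    refine ⟨r, IsUnit.of_mul_eq_one s (hinj ?_), rfl⟩
    rw [map_mul, huv, map_one]

/-- A unit `u` satisfies `u - 1 = (u ^ 2 - u) * u⁻¹`. -/
theorem IsBooleanModConductor.isStronglyLocal (hinj : Function.Injective (algebraMap R B))
    (h : IsBooleanModConductor R B) : IsStronglyLocal R B := by
  refine isStronglyLocal_of_forall_isUnit hinj fun u hu => ?_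
  obtain ⟨v, huv⟩ := isUnit_iff_exists_inv.mp hu
  have h1 : u - 1 ∈ (algebraMap R B).range := by
    convert h u v using 1
    linear_combination (1 - u) * huv
  simpa using add_mem h1 (one_mem _)

theorem IsStronglyLocal.mem_range_of_isUnit (h : IsStronglyLocal R B) {u : B} (hu : IsUnit u) :
    u ∈ (algebraMap R B).range := by
  have hu' : u ∈ algebraMap R B '' {r | IsUnit r} := by rw [h]; exact hu
  obtain ⟨r, -, rfl⟩ := hu'
  exact ⟨r, rfl⟩

theorem isUnit_of_forall_isMaximal_notMem {u : B} (hu : ∀ N : Ideal B, N.IsMaximal → u ∉ N) :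
    IsUnit u := by
  by_contra h
  obtain ⟨N, hN, huN⟩ := exists_max_ideal_of_mem_nonunits h
  exact hu N hN huN

/-- In a strongly local extension `1 + j` is a unit of `B`, hence lies in `R`, for every `j` in
the Jacobson radical of `B`. -/
theorem IsStronglyLocal.mem_range_of_forall_isMaximal_mem (h : IsStronglyLocal R B) {j : B}
    (hj : ∀ N : Ideal B, N.IsMaximal → j ∈ N) : j ∈ (algebraMap R B).range := by
  have h1 : IsUnit (1 + j) := by
    refine isUnit_of_forall_isMaximal_notMem fun N hN hmem => ?_
    refine hN.ne_top ((Ideal.eq_top_iff_one N).mpr ?_)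
    simpa using sub_mem hmem (hj N hN)
  simpa using sub_mem (h.mem_range_of_isUnit h1) (one_mem _)

/-- For `c = (v ^ 2 - v) * w` the Chinese remainder theorem yields units `x`, `y` of `B` such that
`c - (1 - x) * y` lies in the Jacobson radical; both `(1 - x) * y` and the difference then
belong to `R`. -/
theorem IsStronglyLocal.isBooleanModConductor (hB : IsSemilocal B) (h : IsStronglyLocal R B) :
    IsBooleanModConductor R B := by
  classical
  intro v w
  set c := (v ^ 2 - v) * w with hc
  have hfin : Finite {N : Ideal B | N.IsMaximal} := hB
  have hcop : Pairwise (Function.onFun IsCoprime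
      (fun N : {N : Ideal B | N.IsMaximal} => (N : Ideal B))) := fun N N' hNN' => by
    have hN : (N : Ideal B).IsMaximal := N.2
    have hN' : (N' : Ideal B).IsMaximal := N'.2
    change IsCoprime (N : Ideal B) (N' : Ideal B)
    exact Ideal.isCoprime_of_isMaximal (fun h => hNN' (Subtype.ext h))
  -- Where `c ∉ N`, neither `v` nor `-(v * w)` lies in `N`, since both divide `c`; where `c ∈ N`, the
  -- value `1` of `x` makes `(1 - x) * y` vanish modulo `N`.
  obtain ⟨x, hx⟩ := Ideal.exists_forall_sub_mem_ideal hcop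
    (fun N => if c ∈ (N : Ideal B) then 1 else v)
  obtain ⟨y, hy⟩ := Ideal.exists_forall_sub_mem_ideal hcop
    (fun N => if c ∈ (N : Ideal B) then 1 else -(v * w))
  have hunit : ∀ (z : B) (f : B), (f ∣ c) →
      (∀ N : {N : Ideal B | N.IsMaximal},
        z - (if c ∈ (N : Ideal B) then 1 else f) ∈ (N : Ideal B)) →
      IsUnit z := by
    intro z f hf hz
    refine isUnit_of_forall_isMaximal_notMem fun N hN hzN => ?_
    have h1 := hz ⟨N, hN⟩
    have h2 := sub_mem hzN h1
    rw [sub_sub_cancel] at h2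
    split_ifs at h2 with hcN
    · exact hN.ne_top ((Ideal.eq_top_iff_one N).mpr h2)
    · exact hcN (Ideal.mem_of_dvd N hf h2)
  have hxu : IsUnit x := hunit x v ⟨(v - 1) * w, by rw [hc]; ring⟩ hx
  have hyu : IsUnit y := hunit y (-(v * w)) ⟨1 - v, by rw [hc]; ring⟩ hy
  have hj : c - (1 - x) * y ∈ (algebraMap R B).range := by
    refine h.mem_range_of_forall_isMaximal_mem fun N hN => ?_
    have h1 := hx ⟨N, hN⟩
    have h2 := hy ⟨N, hN⟩
    simp only at h1 h2
    split_ifs at h1 h2 with hcN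
    · have : c - (1 - x) * y = c + y * (x - 1) := by ring
      rw [this]
      exact add_mem hcN (N.mul_mem_left _ h1)
    · have : c - (1 - x) * y = y * (x - v) - (1 - v) * (y - -(v * w)) := by rw [hc]; ring
      rw [this]
      exact sub_mem (N.mul_mem_left _ h1) (N.mul_mem_left _ h2)
  have h3 : (1 - x) * y ∈ (algebraMap R B).range :=
    mul_mem (sub_mem (one_mem _) (h.mem_range_of_isUnit hxu)) (h.mem_range_of_isUnit hyu)
  simpa using add_mem hj h3

theorem IsBooleanModConductor.sq_sub_self_mem (h : IsBooleanModConductor R B) (v : B) :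
    v ^ 2 - v ∈ (algebraMap R B).range := by
  simpa using h v 1

theorem IsBooleanModConductor.isSeminormalExtension (h : IsBooleanModConductor R B) :
    IsSeminormalExtension R B := fun b hb2 _ => by
  simpa using sub_mem hb2 (h.sq_sub_self_mem b)

/-- Let `Q` be a prime of `B`. If `Q` contains all `v ^ 2 - v`, then `B / Q` has only the elements
`0` and `1`. Otherwise the conductor contains some `c ∉ Q`, and every fraction `a / b` over
`B / Q` equals the fraction `(c * a) / (c * b)` of elements of `R`. -/
theorem IsBooleanModConductor.isInfraIntegral (h : IsBooleanModConductor R B) :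
    IsInfraIntegral R B := by
  refine ⟨⟨fun v => ?_⟩, fun Q hQ => ⟨RingHom.injective _, fun z => ?_⟩⟩
  · obtain ⟨r, hr⟩ := h.sq_sub_self_mem v
    refine ⟨Polynomial.X ^ 2 - Polynomial.X - Polynomial.C r, ?_, ?_⟩
    · monicity!
    · simp [Polynomial.eval₂_sub, hr]
  · obtain ⟨a, b, -, rfl⟩ := IsFractionRing.div_surjective (A := B ⧸ Q) z
    obtain ⟨a, rfl⟩ := Ideal.Quotient.mk_surjective a
    obtain ⟨b, rfl⟩ := Ideal.Quotient.mk_surjective b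
    rw [Ideal.algebraMap_quotient_residueField_mk, Ideal.algebraMap_quotient_residueField_mk]
    by_cases hc : ∃ v : B, v ^ 2 - v ∉ Q
    · obtain ⟨v, hv⟩ := hc
      obtain ⟨r, hr⟩ := h v a
      obtain ⟨s, hs⟩ := h v b
      refine ⟨algebraMap R _ r / algebraMap R _ s, ?_⟩
      rw [map_div₀, Ideal.ResidueField.map_algebraMap, Ideal.ResidueField.map_algebraMap, hr, hs,
        map_mul, map_mul]
      refine mul_div_mul_left _ _ ?_
      rwa [Ne, Ideal.algebraMap_residueField_eq_zero]
    · push Not at hc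
      have h01 : ∀ v : B, algebraMap B Q.ResidueField v ∈
          (Ideal.ResidueField.map (Q.comap (algebraMap R B)) Q (algebraMap R B) rfl).range := by
        intro v
        have hv : v * (v - 1) ∈ Q := by
          convert hc v using 1
          ring
        rcases hQ.mem_or_mem hv with h0 | h1
        · rw [Ideal.algebraMap_residueField_eq_zero.mpr h0]
          exact zero_mem _
        · rw [← Ideal.algebraMap_residueField_eq_zero, map_sub, map_one, sub_eq_zero] at h1
          rw [h1]
          exact one_mem _
      obtain ⟨a', ha'⟩ := h01 a
      obtain ⟨b', hb'⟩ := h01 b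
      exact ⟨a' / b', by rw [map_div₀, ha', hb']⟩

theorem nonempty_ringEquiv_zmod_two (F : Type*) [CommRing F] [Nontrivial F]
    (h : ∀ x : F, x = 0 ∨ x = 1) : Nonempty (F ≃+* ZMod 2) := by
  have h2 : (2 : F) = 0 := by
    rcases h 2 with h2 | h2
    · exact h2
    · exact absurd (by linear_combination h2 : (1 : F) = 0) one_ne_zero
  have : CharP F 2 := CharTwo.of_one_ne_zero_of_two_eq_zero one_ne_zero h2
  refine ⟨(RingEquiv.ofBijective (ZMod.castHom (dvd_refl 2) F)
    ⟨RingHom.injective _, fun x => ?_⟩).symm⟩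
  rcases h x with rfl | rfl
  · exact ⟨0, map_zero _⟩
  · exact ⟨1, map_one _⟩

theorem IsBooleanModConductor.nonempty_quotient_ringEquiv (h : IsBooleanModConductor R B)
    (p : PrimeSpectrum R) (hp : p ∈ maximalSupport R B) :
    Nonempty ((R ⧸ p.asIdeal) ≃+* ZMod 2) := by
  obtain ⟨hsupp, -⟩ := hp
  obtain ⟨m, hm⟩ := Module.mem_support_iff'.mp hsupp
  obtain ⟨w, rfl⟩ := Submodule.mkQ_surjective _ m
  refine nonempty_ringEquiv_zmod_two _ fun x => ?_
  obtain ⟨r, rfl⟩ := Ideal.Quotient.mk_surjective x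
  have hr : r ^ 2 - r ∈ p.asIdeal := by
    by_contra hr
    refine hm _ hr ?_
    rw [← map_smul, Submodule.mkQ_apply, Submodule.Quotient.mk_eq_zero, Algebra.smul_def]
    obtain ⟨s, hs⟩ := h (algebraMap R B r) w
    exact ⟨s, by simpa using hs⟩
  have hr' : r * (r - 1) ∈ p.asIdeal := by
    convert hr using 1
    ring
  rcases p.isPrime.mem_or_mem hr' with h0 | h1
  · exact Or.inl (Ideal.Quotient.eq_zero_iff_mem.mpr h0)
  · refine Or.inr ?_
    rw [← map_one (Ideal.Quotient.mk p.asIdeal)]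
    exact Ideal.Quotient.eq.mpr h1

end Boolean

section Sup

variable {R S : Type*} [CommRing R] [CommRing S] [Algebra R S]

theorem isBooleanModConductor_iff_forall_mem_bot {V : Subalgebra R S} :
    IsBooleanModConductor R V ↔
      ∀ v ∈ V, ∀ w ∈ V, (v ^ 2 - v) * w ∈ (⊥ : Subalgebra R S) := by
  constructor
  · intro h v hv w hw
    obtain ⟨r, hr⟩ := h ⟨v, hv⟩ ⟨w, hw⟩
    exact ⟨r, congrArg Subtype.val hr⟩
  · rintro h ⟨v, hv⟩ ⟨w, hw⟩
    obtain ⟨r, hr⟩ := h v hv w hw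
    exact ⟨r, Subtype.ext hr⟩

/-- The intersection of the conductors of `R` in `V` and in `W`, as an additive subgroup
of `S`. -/
def conductorInf (V W : Subalgebra R S) : AddSubgroup S where
  carrier := {c | (∀ v ∈ V, c * v ∈ (⊥ : Subalgebra R S)) ∧ ∀ w ∈ W, c * w ∈ (⊥ : Subalgebra R S)}
  zero_mem' := by simp [zero_mem]
  add_mem' := by
    rintro a b ⟨ha, ha'⟩ ⟨hb, hb'⟩
    exact ⟨fun v hv => by rw [add_mul]; exact add_mem (ha v hv) (hb v hv),
      fun v hv => by rw [add_mul]; exact add_mem (ha' v hv) (hb' v hv)⟩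
  neg_mem' := by
    rintro a ⟨ha, ha'⟩
    exact ⟨fun v hv => by rw [neg_mul]; exact neg_mem (ha v hv),
      fun v hv => by rw [neg_mul]; exact neg_mem (ha' v hv)⟩

theorem conductorInf_comm (V W : Subalgebra R S) : conductorInf V W = conductorInf W V :=
  AddSubgroup.ext fun _ => And.comm

theorem mem_bot_of_mem_conductorInf {V W : Subalgebra R S} {c : S} (hc : c ∈ conductorInf V W) :
    c ∈ (⊥ : Subalgebra R S) := by
  simpa using hc.1 1 (one_mem _)

/-- For `v ∈ V` the element `c * v` lies in `R`, its square lies in the conductor of `W`, and so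
does `(c * v) ^ 2 - c * v`. -/
theorem mul_mem_conductorInf {V W : Subalgebra R S} (hW : IsBooleanModConductor R W) {c v : S}
    (hc : c ∈ conductorInf V W) (hv : v ∈ V) : c * v ∈ conductorInf V W := by
  refine ⟨fun v' hv' => by rw [mul_assoc]; exact hc.1 _ (mul_mem hv hv'), fun w hw => ?_⟩
  have hcv : c * v ∈ W := bot_le (a := W) (hc.1 v hv)
  have h1 := isBooleanModConductor_iff_forall_mem_bot.mp hW _ hcv w hw
  have h2 := mul_mem (hc.2 w hw) (hc.1 _ (pow_mem hv 2))
  convert sub_mem h2 h1 using 1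
  ring

theorem mul_mem_conductorInf_of_mem_sup {V W : Subalgebra R S} (hV : IsBooleanModConductor R V)
    (hW : IsBooleanModConductor R W) {c x : S} (hc : c ∈ conductorInf V W) (hx : x ∈ V ⊔ W) :
    c * x ∈ conductorInf V W := by
  let K : Subalgebra R S :=
    { carrier := {x | ∀ c ∈ conductorInf V W, c * x ∈ conductorInf V W}
      mul_mem' := fun {a b} ha hb c hc => by
        rw [← mul_assoc]
        exact hb _ (ha c hc)
      add_mem' := fun {a b} ha hb c hc => by
        rw [mul_add]
        exact add_mem (ha c hc) (hb c hc)
      algebraMap_mem' := fun r c hc => mul_mem_conductorInf hW hc (V.algebraMap_mem r) }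
  have hle : V ⊔ W ≤ K := by
    refine sup_le (fun v hv c hc => mul_mem_conductorInf hW hc hv) (fun w hw c hc => ?_)
    rw [conductorInf_comm] at hc ⊢
    exact mul_mem_conductorInf hV hc hw
  exact hle hx c hc

theorem sq_sub_self_mem_conductorInf_of_mem_bot {V W : Subalgebra R S}
    (hV : IsBooleanModConductor R V) (hW : IsBooleanModConductor R W) {r : S}
    (hr : r ∈ (⊥ : Subalgebra R S)) : r ^ 2 - r ∈ conductorInf V W :=
  ⟨isBooleanModConductor_iff_forall_mem_bot.mp hV r (bot_le (a := V) hr),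
    isBooleanModConductor_iff_forall_mem_bot.mp hW r (bot_le (a := W) hr)⟩

/-- Put `c = v ^ 2 - v`. Both `c` and `c * v` lie in `R`, so they are idempotent modulo `C`, the
intersection of the conductors. As `(c * v) ^ 2 - c * v = (c ^ 2 - c) * v + c ^ 3`, this forces
`c ^ 3`, and hence `c`, into `C`. -/
theorem sq_sub_self_mem_conductorInf {V W : Subalgebra R S} (hV : IsBooleanModConductor R V)
    (hW : IsBooleanModConductor R W) {v : S} (hv : v ∈ V) : v ^ 2 - v ∈ conductorInf V W := by
  have hV' := isBooleanModConductor_iff_forall_mem_bot.mp hV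
  have hc : v ^ 2 - v ∈ (⊥ : Subalgebra R S) := by simpa using hV' v hv 1 (one_mem _)
  have h1 := sq_sub_self_mem_conductorInf_of_mem_bot hV hW hc
  have h2 := sq_sub_self_mem_conductorInf_of_mem_bot hV hW (hV' v hv v hv)
  have h3 := mul_mem_conductorInf hW h1 hv
  have h4 := mul_mem_conductorInf hW h1 (bot_le (a := V) hc)
  have h5 := sub_mem (sub_mem (sub_mem h2 h3) h4) h1
  convert h5 using 1
  ring

/-- Modulo the intersection of the conductors, which is an ideal of `V ⊔ W`, the ring `V ⊔ W` has
characteristic two and is generated by idempotents, so it is Boolean. -/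
theorem IsBooleanModConductor.sup {V W : Subalgebra R S} (hV : IsBooleanModConductor R V)
    (hW : IsBooleanModConductor R W) : IsBooleanModConductor R ↥(V ⊔ W) := by
  have hmul : ∀ {c x : S}, c ∈ conductorInf V W → x ∈ V ⊔ W → c * x ∈ conductorInf V W :=
    fun hc hx => mul_mem_conductorInf_of_mem_sup hV hW hc hx
  have hbot : ∀ {r : S}, r ∈ (⊥ : Subalgebra R S) → r ^ 2 - r ∈ conductorInf V W :=
    fun hr => sq_sub_self_mem_conductorInf_of_mem_bot hV hW hr
  let K : Subalgebra R S :=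
    { carrier := {x | x ∈ V ⊔ W ∧ x ^ 2 - x ∈ conductorInf V W}
      mul_mem' := by
        rintro a b ⟨ha, ha'⟩ ⟨hb, hb'⟩
        refine ⟨mul_mem ha hb, ?_⟩
        convert add_mem (hmul ha' (pow_mem hb 2)) (hmul hb' ha) using 1
        ring
      add_mem' := by
        rintro a b ⟨ha, ha'⟩ ⟨hb, hb'⟩
        refine ⟨add_mem ha hb, ?_⟩
        have h2 : (2 : S) ∈ conductorInf V W := by
          convert hbot (ofNat_mem (⊥ : Subalgebra R S) 2) using 1
          norm_num
        convert add_mem (add_mem ha' hb') (hmul h2 (mul_mem ha hb)) using 1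
        ring
      algebraMap_mem' := fun r =>
        ⟨Subalgebra.algebraMap_mem _ r, hbot (Subalgebra.algebraMap_mem _ r)⟩ }
  have hle : V ⊔ W ≤ K := by
    refine sup_le (fun v hv => ⟨le_sup_left (a := V) hv, sq_sub_self_mem_conductorInf hV hW hv⟩)
      (fun w hw => ⟨le_sup_right (a := V) hw, ?_⟩)
    rw [conductorInf_comm]
    exact sq_sub_self_mem_conductorInf hW hV hw
  rw [isBooleanModConductor_iff_forall_mem_bot]
  intro x hx y hy
  exact mem_bot_of_mem_conductorInf (hmul (hle hx).2 hy)

end Sup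

/-! ### Semilocality of intermediate rings -/

section Minimal

open Polynomial

variable {A B : Type*} [CommRing A] [CommRing B] [Algebra A B]

/-- The elements of `B` that become elements of `A` after localization at the prime `M` of `A`. -/
def localizedBot (B : Type*) [CommRing B] [Algebra A B] (M : Ideal A) [M.IsPrime] :
    Subalgebra A B where
  carrier := {b | ∃ t ∉ M, t • b ∈ (⊥ : Subalgebra A B)}
  mul_mem' := by
    rintro a b ⟨s, hs, hsa⟩ ⟨t, ht, htb⟩
    refine ⟨s * t, fun h => (Ideal.IsPrime.mem_or_mem ‹_› h).elim hs ht, ?_⟩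
    rw [← smul_mul_smul_comm]
    exact mul_mem hsa htb
  add_mem' := by
    rintro a b ⟨s, hs, hsa⟩ ⟨t, ht, htb⟩
    refine ⟨s * t, fun h => (Ideal.IsPrime.mem_or_mem ‹_› h).elim hs ht, ?_⟩
    rw [smul_add]
    refine add_mem ?_ ?_
    · rw [mul_comm, mul_smul]
      exact Subalgebra.smul_mem _ hsa t
    · rw [mul_smul]
      exact Subalgebra.smul_mem _ htb s
  algebraMap_mem' := fun r =>
    ⟨1, fun h => Ideal.IsPrime.ne_top ‹_› ((Ideal.eq_top_iff_one M).mpr h), by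
      rw [one_smul]
      exact Subalgebra.algebraMap_mem _ r⟩

/-- Let `A` be integrally closed in `B`. If the value at `y` of a polynomial
`a₀ + a₁ X + ⋯ + aₙ X ^ n` lies in `A`, then so does the value of `a₁ + a₂ X + ⋯ + aₙ X ^ (n - 1)`:
the element `aₙ y` is integral over `A`, hence can be absorbed into the coefficient `aₙ₋₁`. -/
theorem aeval_divX_mem_bot (hic : ∀ x : B, IsIntegral A x → x ∈ (⊥ : Subalgebra A B)) (y : B)
    (n : ℕ) (f : A[X]) (hn : f.natDegree ≤ n) (hf : aeval y f ∈ (⊥ : Subalgebra A B)) :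
    aeval y f.divX ∈ (⊥ : Subalgebra A B) := by
  induction n generalizing f with
  | zero =>
    rw [natDegree_eq_zero.mp (Nat.le_zero.mp hn) |>.choose_spec.symm, divX_C, map_zero]
    exact zero_mem _
  | succ n ih =>
    rcases hn.lt_or_eq with hlt | heq
    · exact ih f (Nat.lt_succ_iff.mp hlt) hf
    obtain ⟨c, hc⟩ := hf
    have hint : IsIntegral A (f.coeff (n + 1) • y) := by
      have h1 := isIntegral_leadingCoeff_smul (f - C c) y (by
        rw [map_sub, aeval_C, sub_eq_zero]
        exact hc.symm)
      rwa [leadingCoeff, natDegree_sub_C, heq, coeff_sub, coeff_C_succ, sub_zero] at h1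
    obtain ⟨s, hs⟩ := hic _ hint
    replace hs : algebraMap A B s = algebraMap A B (f.coeff (n + 1)) * y := by
      rw [← Algebra.smul_def]
      exact hs
    rcases Nat.eq_zero_or_pos n with rfl | hpos
    · have : f.divX = C (f.coeff 1) := by
        refine Polynomial.ext fun k => ?_
        rw [coeff_divX, coeff_C]
        split_ifs with hk
        · rw [hk]
        · exact coeff_eq_zero_of_natDegree_lt (by omega)
      rw [this, aeval_C]
      exact Subalgebra.algebraMap_mem _ _
    · let g : A[X] := f - C (f.coeff (n + 1)) * X ^ (n + 1) + C s * X ^ n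
      have hg : g.natDegree ≤ n := by
        rw [natDegree_le_iff_coeff_eq_zero]
        intro k hk
        have hkn : k ≠ n := by omega
        simp only [g, coeff_add, coeff_sub, coeff_C_mul_X_pow, if_neg hkn, add_zero]
        split_ifs with hk'
        · rw [hk', sub_self]
        · rw [sub_zero]
          exact coeff_eq_zero_of_natDegree_lt (by omega)
      have hgy : aeval y g = aeval y f := by
        simp only [g, map_add, map_sub, map_mul, map_pow, aeval_C, aeval_X, hs]
        ring
      have hfg : f + C s * X ^ n = g + C (f.coeff (n + 1)) * X ^ (n + 1) := by
        simp only [g]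
        ring
      have h1 := ih g hg (by rw [hgy]; exact ⟨c, hc⟩)
      have h2 : aeval y f.divX = aeval y g.divX := by
        obtain ⟨m, rfl⟩ : ∃ m, n = m + 1 := ⟨n - 1, by omega⟩
        have h3 := congrArg (fun q : A[X] => aeval y q.divX) hfg
        simp only [divX_add, divX_C_mul_X_pow, map_add, Nat.succ_ne_zero, if_false, map_mul,
          map_pow, aeval_C, aeval_X, Nat.add_sub_cancel, hs] at h3
        linear_combination h3
      rw [h2]
      exact h1

/-- The case of a minimal extension `A ⊆ B` with `A` integrally closed in `B`: writing `b` as a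
polynomial in `t * b`, where `t` lies in `M` but not in `M'`, exhibits `(1 - t * s) * b ∈ A` with
`s ∈ A`. -/
theorem mem_localizedBot_of_mem_adjoin_smul
    (hic : ∀ x : B, IsIntegral A x → x ∈ (⊥ : Subalgebra A B)) {M M' : Ideal A} [M.IsPrime]
    [M'.IsPrime] (hM' : localizedBot B M' = ⊥) {t : A} (htM : t ∈ M) (htM' : t ∉ M') {b : B}
    (hb : b ∈ Algebra.adjoin A {t • b}) : b ∈ localizedBot B M := by
  rw [Algebra.adjoin_singleton_eq_range_aeval] at hb
  obtain ⟨p, hp⟩ := hb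
  replace hp : aeval (t • b) p = b := hp
  have h1 : aeval (t • b) (C t * p - X) ∈ (⊥ : Subalgebra A B) := by
    rw [map_sub, map_mul, hp, aeval_C, aeval_X, ← Algebra.smul_def, sub_self]
    exact zero_mem _
  have h2 := aeval_divX_mem_bot hic _ _ _ le_rfl h1
  have hX : (X : A[X]).divX = 1 := by
    have := divX_X_pow (R := A) (n := 1)
    simpa using this
  have h3 : t • aeval (t • b) p.divX ∈ (⊥ : Subalgebra A B) := by
    have h4 := add_mem h2 (one_mem (⊥ : Subalgebra A B))
    have h5 : (C t * p - X).divX = C t * p.divX - 1 := by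
      rw [sub_eq_add_neg, ← neg_one_mul, ← C_1, ← C_neg, divX_add, divX_C_mul, divX_C_mul, hX]
      simp [sub_eq_add_neg]
    rw [h5, map_sub, map_one, sub_add_cancel, map_mul, aeval_C, ← Algebra.smul_def] at h4
    exact h4
  have h6 : aeval (t • b) p.divX ∈ (⊥ : Subalgebra A B) := by
    rw [← hM']
    exact ⟨t, htM', h3⟩
  obtain ⟨s, hs⟩ := h6
  replace hs : algebraMap A B s = aeval (t • b) p.divX := hs
  refine ⟨1 - t * s, fun hmem => ?_, ⟨p.coeff 0, ?_⟩⟩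
  · refine Ideal.IsPrime.ne_top ‹M.IsPrime› ((Ideal.eq_top_iff_one M).mpr ?_)
    simpa using add_mem hmem (M.mul_mem_right s htM)
  · have h7 := congrArg (aeval (t • b)) (divX_mul_X_add p)
    rw [map_add, map_mul, aeval_X, aeval_C, hp, ← hs, Algebra.smul_def] at h7
    change algebraMap A B (p.coeff 0) = (1 - t * s) • b
    rw [Algebra.smul_def, map_sub, map_one, map_mul]
    linear_combination h7

/-- The case of a minimal extension `A ⊆ B` with `B` finite over `A`: if `B = A + t B` with
`t ∈ M`, then Nakayama's lemma applies to `B / A`. -/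
theorem mem_localizedBot_of_adjoin_smul_eq_top [Module.Finite A B] {M : Ideal A} [M.IsPrime]
    {t : A} (htM : t ∈ M) {b : B} (hb : Algebra.adjoin A {t • b} = ⊤) (x : B) :
    x ∈ localizedBot B M := by
  let N : Submodule A B := Subalgebra.toSubmodule ⊥
  have hle : (⊤ : Submodule A (B ⧸ N)) ≤ Ideal.span {t} • ⊤ := by
    intro z _
    obtain ⟨z, rfl⟩ := N.mkQ_surjective z
    have hz : z ∈ Algebra.adjoin A {t • b} := by rw [hb]; trivial
    rw [Algebra.adjoin_singleton_eq_range_aeval] at hz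
    obtain ⟨p, hp⟩ := hz
    replace hp : aeval (t • b) p = z := hp
    have h7 := congrArg (aeval (t • b)) (divX_mul_X_add p)
    rw [map_add, map_mul, aeval_X, aeval_C, hp] at h7
    have h8 : N.mkQ z = t • N.mkQ (aeval (t • b) p.divX * b) := by
      rw [← map_smul, ← sub_eq_zero, ← map_sub, Submodule.mkQ_apply, Submodule.Quotient.mk_eq_zero]
      refine ⟨p.coeff 0, ?_⟩
      change algebraMap A B (p.coeff 0) = _
      rw [← h7, Algebra.smul_def, Algebra.smul_def]
      ring
    rw [h8]
    exact Submodule.smul_mem_smul (Ideal.mem_span_singleton_self t) trivial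
  obtain ⟨r, hr, hr0⟩ := Submodule.exists_sub_one_mem_and_smul_eq_zero_of_fg_of_le_smul
    (Ideal.span {t}) (⊤ : Submodule A (B ⧸ N)) Module.Finite.fg_top hle
  have hrM : r - 1 ∈ M := (Ideal.span_singleton_le_iff_mem M).mpr htM hr
  refine ⟨r, fun h => ?_, ?_⟩
  · refine Ideal.IsPrime.ne_top ‹M.IsPrime› ((Ideal.eq_top_iff_one M).mpr ?_)
    simpa using sub_mem h hrM
  · have := hr0 (N.mkQ x) trivial
    rwa [← map_smul, Submodule.mkQ_apply, Submodule.Quotient.mk_eq_zero] at this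

/-- A minimal ring extension is trivial locally at all maximal ideals but one (Ferrand and
Olivier). -/
theorem eq_of_localizedBot_ne_top (hmin : ∀ C : Subalgebra A B, C = ⊥ ∨ C = ⊤) {M M' : Ideal A}
    [M.IsMaximal] [M'.IsMaximal] (hM : localizedBot B M ≠ ⊤) (hM' : localizedBot B M' ≠ ⊤) :
    M = M' := by
  by_contra hne
  have hbM := (hmin _).resolve_right hM
  have hbM' := (hmin _).resolve_right hM'
  obtain ⟨t, htM, htM'⟩ : ∃ t ∈ M, t ∉ M' := by
    by_contra! hcon
    exact hne (Ideal.IsMaximal.eq_of_le ‹_› (Ideal.IsMaximal.ne_top ‹_›) hcon)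
  obtain ⟨b, hb⟩ : ∃ b : B, b ∉ (⊥ : Subalgebra A B) := by
    by_contra! hcon
    exact hM (hbM.trans (eq_top_iff.mpr fun x _ => hcon x))
  have htop : Algebra.adjoin A {t • b} = ⊤ := by
    refine (hmin _).resolve_left fun hbot => hb ?_
    rw [← hbM']
    refine ⟨t, htM', ?_⟩
    rw [← hbot]
    exact Algebra.self_mem_adjoin_singleton A _
  rcases hmin (integralClosure A B) with hic | hic
  · refine hb (hbM ▸ mem_localizedBot_of_mem_adjoin_smul (fun x hx => ?_) hbM' htM htM'
      (htop ▸ Algebra.mem_top))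
    rw [← hic]
    exact hx
  · have hfin : Module.Finite A B := by
      refine ⟨?_⟩
      have h1 : IsIntegral A (t • b) := by
        have : t • b ∈ integralClosure A B := by rw [hic]; trivial
        exact this
      have h2 := h1.fg_adjoin_singleton
      rwa [htop] at h2
    exact hM (eq_top_iff.mpr fun x _ => mem_localizedBot_of_adjoin_smul_eq_top htM htop x)

/-- A maximal ideal of `A` at which `A` and `B` agree locally is the contraction of a maximal ideal
of `B`. -/
theorem exists_isMaximal_comap_eq_of_localizedBot_eq_top
    (hinj : Function.Injective (algebraMap A B)) {M : Ideal A} [M.IsMaximal]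
    (hM : localizedBot B M = ⊤) :
    ∃ N : Ideal B, N.IsMaximal ∧ N.comap (algebraMap A B) = M := by
  have hkey : ∀ x ∈ M.map (algebraMap A B), ∃ t ∉ M, ∃ m ∈ M, t • x = algebraMap A B m := by
    intro x hx
    induction hx using Submodule.span_induction with
    | mem x hx =>
      obtain ⟨m, hm, rfl⟩ := hx
      exact ⟨1, (Ideal.ne_top_iff_one M).mp (Ideal.IsMaximal.ne_top ‹_›), m, hm, one_smul _ _⟩
    | zero =>
      exact ⟨1, (Ideal.ne_top_iff_one M).mp (Ideal.IsMaximal.ne_top ‹_›), 0, zero_mem _, by simp⟩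
    | add x y _ _ hx hy =>
      obtain ⟨s, hs, m, hm, hsx⟩ := hx
      obtain ⟨t, ht, n, hn, hty⟩ := hy
      refine ⟨s * t, fun h => (Ideal.IsPrime.mem_or_mem inferInstance h).elim hs ht,
        t * m + s * n, add_mem (M.mul_mem_left _ hm) (M.mul_mem_left _ hn), ?_⟩
      rw [Algebra.smul_def] at hsx hty ⊢
      simp only [map_mul, map_add, ← hsx, ← hty]
      ring
    | smul a x _ hx =>
      obtain ⟨s, hs, m, hm, hsx⟩ := hx
      have ha : a ∈ localizedBot B M := by rw [hM]; trivial
      obtain ⟨t, ht, c, hc⟩ := ha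
      replace hc : algebraMap A B c = t • a := hc
      refine ⟨t * s, fun h => (Ideal.IsPrime.mem_or_mem inferInstance h).elim ht hs,
        c * m, M.mul_mem_left _ hm, ?_⟩
      rw [map_mul, hc, ← hsx, smul_mul_smul_comm, smul_eq_mul]
  have hne : M.map (algebraMap A B) ≠ ⊤ := by
    intro htop
    obtain ⟨t, ht, m, hm, htm⟩ := hkey 1 (by rw [htop]; trivial)
    rw [Algebra.smul_def, mul_one] at htm
    exact ht (hinj htm ▸ hm)
  obtain ⟨N, hN, hle⟩ := Ideal.exists_le_maximal _ hne
  refine ⟨N, hN, ?_⟩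
  have hNp := hN.isPrime
  exact (Ideal.IsMaximal.eq_of_le ‹M.IsMaximal› (Ideal.IsPrime.ne_top inferInstance)
    (Ideal.map_le_iff_le_comap.mp hle)).symm

theorem IsSemilocal.of_minimal_extension (hB : IsSemilocal B)
    (hinj : Function.Injective (algebraMap A B))
    (hmin : ∀ C : Subalgebra A B, C = ⊥ ∨ C = ⊤) : IsSemilocal A := by
  have h1 : {M : Ideal A | ∃ _ : M.IsMaximal, localizedBot B M ≠ ⊤}.Subsingleton := by
    rintro M ⟨hM, hM'⟩ N ⟨hN, hN'⟩
    exact eq_of_localizedBot_ne_top hmin hM' hN'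
  refine ((hB.image (Ideal.comap (algebraMap A B))).union h1.finite).subset fun M hM => ?_
  have hM' : M.IsMaximal := hM
  by_cases h : localizedBot B M = ⊤
  · exact Or.inl (exists_isMaximal_comap_eq_of_localizedBot_eq_top hinj h)
  · exact Or.inr ⟨hM', h⟩

end Minimal

section FCP

variable {R S : Type*} [CommRing R] [CommRing S] [Algebra R S]

theorem IsFCPExtension.wellFoundedGT (h : IsFCPExtension R S) :
    WellFoundedGT (Subalgebra R S) := by
  refine ⟨RelEmbedding.wellFounded_iff_isEmpty.mpr ⟨fun f => ?_⟩⟩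
  have hf : StrictMono f := fun _ _ hab => f.map_rel_iff.mpr hab
  exact Set.infinite_range_of_injective f.injective (h _ hf.monotone.isChain_range)

theorem IsFCPExtension.wellFoundedLT (h : IsFCPExtension R S) :
    WellFoundedLT (Subalgebra R S) := by
  refine ⟨RelEmbedding.wellFounded_iff_isEmpty.mpr ⟨fun f => ?_⟩⟩
  have hf : StrictAnti f := fun _ _ hab => f.map_rel_iff.mpr hab
  exact Set.infinite_range_of_injective f.injective (h _ hf.antitone.isChain_range)

theorem IsSemilocal.of_covBy {V W : Subalgebra R S} (h : V ⋖ W) (hW : IsSemilocal W) :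
    IsSemilocal V := by
  let : Algebra V W := (Subalgebra.inclusion h.le).toAlgebra
  refine hW.of_minimal_extension (A := V) (B := W)
    (Subalgebra.inclusion_injective h.le) (fun C => ?_)
  have : IsScalarTower R V W := IsScalarTower.of_algebraMap_eq fun r => rfl
  let D : Subalgebra R S := (C.restrictScalars R).map W.val
  have hVD : V ≤ D := fun v hv => ⟨⟨v, h.le hv⟩, C.algebraMap_mem ⟨v, hv⟩, rfl⟩
  have hDW : D ≤ W := by
    rintro _ ⟨w, -, rfl⟩
    exact w.2
  rcases h.eq_or_eq hVD hDW with hD | hD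
  · left
    rw [eq_bot_iff]
    intro w hw
    have : (w : S) ∈ D := ⟨w, hw, rfl⟩
    rw [hD] at this
    exact ⟨⟨w, this⟩, rfl⟩
  · right
    rw [eq_top_iff]
    intro w _
    have : (w : S) ∈ D := by rw [hD]; exact w.2
    obtain ⟨w', hw', heq⟩ := this
    exact (Subtype.ext heq : w' = w) ▸ hw'

theorem IsFCPExtension.isSemilocal (h : IsFCPExtension R S) (hS : IsSemilocal S)
    (V : Subalgebra R S) : IsSemilocal V := by
  have := h.wellFoundedGT
  have := h.wellFoundedLT
  induction V using WellFoundedGT.induction with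
  | ind V ih =>
    rcases eq_or_lt_of_le (le_top (a := V)) with rfl | hlt
    -- `⊤` is a copy of `S`, so the extension `⊤ ⊆ S` has no proper intermediate rings at all.
    · refine hS.of_minimal_extension (A := (⊤ : Subalgebra R S)) Subtype.val_injective
        fun C => Or.inr (eq_top_iff.mpr fun x _ => ?_)
      exact C.algebraMap_mem ⟨x, trivial⟩
    · obtain ⟨W, hVW, -⟩ := exists_covBy_le_of_lt hlt
      exact (ih W hVW.lt).of_covBy hVW

end FCP

/-! ### Seminormal infra-integral extensions -/

section Seminormal

variable {R B : Type*} [CommRing R] [CommRing B] [Algebra R B]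

theorem IsFCPExtension.subalgebra {S : Type*} [CommRing S] [Algebra R S]
    (h : IsFCPExtension R S) (V : Subalgebra R S) : IsFCPExtension R V := by
  intro C hC
  have hchain : IsChain (· ≤ ·) (Subalgebra.map V.val '' C) := by
    rintro _ ⟨D, hD, rfl⟩ _ ⟨E, hE, rfl⟩ hne
    exact (hC hD hE fun h => hne (h ▸ rfl)).imp (Subalgebra.map_mono ·) (Subalgebra.map_mono ·)
  exact (h _ hchain).of_finite_image (Subalgebra.map_injective Subtype.val_injective).injOn

/-- By the ascending chain condition `B` is a finitely generated algebra. -/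
theorem IsFCPExtension.moduleFinite [Algebra.IsIntegral R B] (h : IsFCPExtension R B) :
    Module.Finite R B := by
  classical
  have := h.wellFoundedGT
  obtain ⟨_, ⟨s, rfl⟩, hmax⟩ := WellFoundedGT.exists_maximal ‹_›
    (Set.range fun s : Finset B => Algebra.adjoin R (s : Set B)) (Set.range_nonempty _)
  have htop : Algebra.adjoin R (s : Set B) = ⊤ := by
    refine eq_top_iff.mpr fun x _ => ?_
    refine hmax ⟨insert x s, rfl⟩ (Algebra.adjoin_mono (by simp)) (Algebra.subset_adjoin (by simp))
  refine ⟨?_⟩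
  have h1 := fg_adjoin_of_finite s.finite_toSet fun x _ => Algebra.IsIntegral.isIntegral (R := R) x
  rwa [htop] at h1

/-- The descending chain of the rings `R + I ^ k B` becomes stationary, so Nakayama's lemma applies
to the image of `I ^ k B` in `B / R`. -/
theorem IsFCPExtension.exists_smul_mem_bot [Module.Finite R B] (h : IsFCPExtension R B)
    {I : Ideal R} (hI : I.FG) :
    ∃ k, ∃ r : R, r - 1 ∈ I ∧
      ∀ x ∈ (I ^ k).map (algebraMap R B), r • x ∈ (⊥ : Subalgebra R B) := by
  have := h.wellFoundedLT
  let C : ℕ → Subalgebra R B := fun k =>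
    (⊥ : Subalgebra R (B ⧸ (I ^ k).map (algebraMap R B))).comap (Ideal.Quotient.mkₐ R _)
  have hC : ∀ {k x}, x ∈ C k ↔
      ∃ r : R, x - algebraMap R B r ∈ (I ^ k).map (algebraMap R B) := by
    intro k x
    constructor
    · rintro ⟨r, hr⟩
      exact ⟨r, Ideal.Quotient.eq.mp hr.symm⟩
    · rintro ⟨r, hr⟩
      exact ⟨r, (Ideal.Quotient.eq.mpr hr).symm⟩
  have hanti : Antitone C := fun m n hmn x hx => by
    obtain ⟨r, hr⟩ := hC.mp hx
    exact hC.mpr ⟨r, Ideal.map_mono (Ideal.pow_le_pow_right hmn) hr⟩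
  obtain ⟨k, hk⟩ := WellFoundedLT.antitone_chain_condition hanti
  let L : Submodule R B := Subalgebra.toSubmodule ⊥
  have hmap : ∀ j x, x ∈ (I ^ j).map (algebraMap R B) ↔ x ∈ I ^ j • (⊤ : Submodule R B) := by
    intro j x
    rw [Ideal.smul_top_eq_map]
    rfl
  let N : Submodule R (B ⧸ L) := (I ^ k • (⊤ : Submodule R B)).map L.mkQ
  have hNfg : N.FG := (Submodule.FG.smul hI.pow Module.Finite.fg_top).map _
  have hle : N ≤ I • N := by
    rintro _ ⟨x, hx, rfl⟩
    have hxk : x ∈ C k := hC.mpr ⟨0, by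
      rw [map_zero, sub_zero]
      exact (hmap _ _).mpr hx⟩
    have hxk' : x ∈ C (k + 1) := by
      have h1 : C k = C (k + 1) := hk (k + 1) (Nat.le_succ k)
      rwa [← h1]
    obtain ⟨r, hr⟩ := hC.mp hxk'
    have h2 : L.mkQ x = L.mkQ (x - algebraMap R B r) := by
      rw [← sub_eq_zero, ← map_sub, sub_sub_cancel, Submodule.mkQ_apply,
        Submodule.Quotient.mk_eq_zero]
      exact ⟨r, rfl⟩
    rw [h2, ← Submodule.map_smul'', ← mul_smul, ← pow_succ']
    exact Submodule.mem_map_of_mem ((hmap _ _).mp hr)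
  obtain ⟨r, hr, hr0⟩ :=
    Submodule.exists_sub_one_mem_and_smul_eq_zero_of_fg_of_le_smul I N hNfg hle
  refine ⟨k, r, hr, fun x hx => ?_⟩
  have := hr0 _ (Submodule.mem_map_of_mem (f := L.mkQ) ((hmap _ _).mp hx))
  rwa [← map_smul, Submodule.mkQ_apply, Submodule.Quotient.mk_eq_zero] at this

theorem Ideal.exists_fg_le_mem_map {M : Ideal R} {x : B} (hx : x ∈ M.map (algebraMap R B)) :
    ∃ I ≤ M, I.FG ∧ x ∈ I.map (algebraMap R B) := by
  classical
  obtain ⟨T, hT, hxT⟩ := Submodule.mem_span_finite_of_mem_span hx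
  obtain ⟨s, hs, rfl⟩ := Finset.subset_set_image_iff.mp hT
  refine ⟨Ideal.span s, Ideal.span_le.mpr hs, ⟨s, rfl⟩, ?_⟩
  rw [Ideal.map_span, ← Finset.coe_image]
  exact hxT

/-- High powers of an element of the radical of `M B` lie in `R` locally at `M`. -/
theorem IsFCPExtension.exists_smul_pow_mem_bot (h : IsFCPExtension R B)
    [Algebra.IsIntegral R B] {M : Ideal R} [M.IsMaximal] {x : B}
    (hx : x ∈ (M.map (algebraMap R B)).radical) :
    ∃ t ∉ M, ∃ k, ∀ j, k ≤ j → t • x ^ j ∈ (⊥ : Subalgebra R B) := by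
  have := h.moduleFinite
  obtain ⟨d, hd⟩ := hx
  obtain ⟨I, hIM, hI, hdI⟩ := Ideal.exists_fg_le_mem_map hd
  obtain ⟨k, t, ht, hk⟩ := h.exists_smul_mem_bot hI
  refine ⟨t, fun htM => ?_, d * k, fun j hj => hk _ ?_⟩
  · refine Ideal.IsPrime.ne_top inferInstance ((Ideal.eq_top_iff_one M).mpr ?_)
    simpa using sub_mem htM (hIM ht)
  · obtain ⟨i, rfl⟩ := Nat.exists_eq_add_of_le hj
    rw [pow_add, pow_mul, Ideal.map_pow]
    exact Ideal.mul_mem_right _ _ (Ideal.pow_mem_pow hdI k)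

/-- Descending induction on the exponent: if `t * x ^ j` lies in `R` for all `j ≥ k`, where
`k ≥ 2`, then the square and the cube of `t * x ^ (k - 1)` lie in `R`. -/
theorem IsSeminormalExtension.smul_mem_bot (h : IsSeminormalExtension R B) {x : B} {t : R} (k : ℕ)
    (hk : ∀ j, k ≤ j → t • x ^ j ∈ (⊥ : Subalgebra R B)) : t • x ∈ (⊥ : Subalgebra R B) := by
  induction k with
  | zero => simpa using hk 1 (Nat.zero_le _)
  | succ k ih =>
    rcases Nat.eq_zero_or_pos k with rfl | hpos
    · simpa using hk 1 le_rfl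
    refine ih fun j hj => ?_
    rcases hj.eq_or_lt with rfl | hlt
    · refine h (t • x ^ k) ?_ ?_
      · obtain ⟨b, hb⟩ := Subalgebra.smul_mem _ (hk (k * 2) (by omega)) t
        refine ⟨b, hb.trans ?_⟩
        rw [smul_pow, ← pow_mul, smul_smul, ← pow_two]
      · obtain ⟨b, hb⟩ := Subalgebra.smul_mem _ (hk (k * 3) (by omega)) (t ^ 2)
        refine ⟨b, hb.trans ?_⟩
        rw [smul_pow, ← pow_mul, smul_smul, ← pow_succ]
    · exact hk j hlt

/-- If a prime `Q` lies over a maximal ideal with residue field `ℤ/2ℤ` and the residual extension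
at `Q` is trivial, then every unit is congruent to `1` modulo `Q`. -/
theorem IsInfraIntegral.sub_one_mem (h : IsInfraIntegral R B) (Q : Ideal B) [Q.IsPrime]
    {M : Ideal R} [M.IsMaximal] (hM : Q.comap (algebraMap R B) = M)
    (e : (R ⧸ M) ≃+* ZMod 2) {u : B} (hu : IsUnit u) : u - 1 ∈ Q := by
  subst hM
  obtain ⟨z, hz⟩ := (h.2 Q).2 (algebraMap B Q.ResidueField u)
  obtain ⟨r, rfl⟩ := Ideal.algebraMap_residueField_surjective (Q.comap (algebraMap R B)) z
  rw [Ideal.ResidueField.map_algebraMap] at hz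
  have hmk : ∀ a : ZMod 2, a = 0 ∨ a = 1 := by decide
  have hr : algebraMap R B r - u ∈ Q := by
    rw [← Ideal.algebraMap_residueField_eq_zero, map_sub, hz, sub_self]
  rcases hmk (e (Ideal.Quotient.mk _ r)) with h0 | h1
  · rw [map_eq_zero_iff e e.injective, Ideal.Quotient.eq_zero_iff_mem, Ideal.mem_comap] at h0
    refine absurd (Ideal.eq_top_of_isUnit_mem Q ?_ hu) (Ideal.IsPrime.ne_top ‹_›)
    simpa using sub_mem h0 hr
  · rw [map_eq_one_iff e e.injective, ← map_one (Ideal.Quotient.mk _), Ideal.Quotient.eq,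
      Ideal.mem_comap, map_sub, map_one] at h1
    simpa using sub_mem h1 hr

/-- If some unit `u` of `B` lay outside `R`, then `R : u` would be contained in a maximal ideal `M` in
the support of `B / R`. By infra-integrality `u - 1` lies in the radical of `M B`, so high powers of
`u - 1` lie in `R` locally at `M`; by seminormality so does `u - 1` itself. -/
theorem IsSeminormalExtension.isStronglyLocal (hinj : Function.Injective (algebraMap R B))
    (hFCP : IsFCPExtension R B) (hs : IsSeminormalExtension R B) (hi : IsInfraIntegral R B)
    (hres : ∀ p ∈ maximalSupport R B, Nonempty ((R ⧸ p.asIdeal) ≃+* ZMod 2)) :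
    IsStronglyLocal R B := by
  have hint := hi.1
  refine isStronglyLocal_of_forall_isUnit hinj fun u hu => ?_
  by_contra hubot
  let J : Ideal R := (Subalgebra.toSubmodule (⊥ : Subalgebra R B)).comap
    (LinearMap.toSpanSingleton R B u)
  have hJ : ∀ {r}, r ∈ J ↔ r • u ∈ (⊥ : Subalgebra R B) := Iff.rfl
  have hJtop : J ≠ ⊤ := by
    rw [Ideal.ne_top_iff_one, hJ, one_smul]
    exact hubot
  obtain ⟨M, hM, hle⟩ := Ideal.exists_le_maximal J hJtop
  have hsupp : (⟨M, hM.isPrime⟩ : PrimeSpectrum R) ∈ maximalSupport R B := by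
    refine ⟨Module.mem_support_iff'.mpr ⟨Submodule.Quotient.mk u, fun r hr hr0 => hr (hle ?_)⟩, hM⟩
    rw [← Submodule.Quotient.mk_smul, Submodule.Quotient.mk_eq_zero] at hr0
    exact hr0
  obtain ⟨e⟩ := hres _ hsupp
  have hrad : u - 1 ∈ (M.map (algebraMap R B)).radical := by
    rw [Ideal.radical_eq_sInf, Submodule.mem_sInf]
    rintro Q ⟨hMQ, hQ⟩
    refine hi.sub_one_mem Q (M := M) ?_ e hu
    exact (hM.eq_of_le (Ideal.IsPrime.ne_top inferInstance)
      (Ideal.map_le_iff_le_comap.mp hMQ)).symm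
  obtain ⟨t, ht, k, hk⟩ := hFCP.exists_smul_pow_mem_bot hrad
  refine ht (hle (hJ.mpr ?_))
  have h1 := add_mem (hs.smul_mem_bot k hk) (Subalgebra.smul_mem _ (one_mem _) t)
  rwa [← smul_add, sub_add_cancel] at h1

end Seminormal

/-! ### The greatest strongly local subextension -/

theorem IsGreatest.eq_compositum_and_isLUB_and_eq_iUnion {R S : Type*} [CommRing R]
    [CommRing S] [Algebra R S]
    {F : Set (Subalgebra R S)} {T : Subalgebra R S} (h : IsGreatest F T) :
    T = compositum F ∧ IsLUB F T ∧ (T : Set S) = ⋃ V ∈ F, (V : Set S) := by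
  have hU : (T : Set S) = ⋃ V ∈ F, (V : Set S) :=
    (Set.subset_biUnion_of_mem (u := fun V : Subalgebra R S => (V : Set S)) h.1).antisymm
      (Set.iUnion₂_subset fun V hV => h.2 hV)
  exact ⟨by rw [compositum, ← hU, Algebra.adjoin_eq], h.isLUB, hU⟩

theorem IsFCPExtension.exists_isGreatest {R S : Type*} [CommRing R] [CommRing S] [Algebra R S]
    (h : IsFCPExtension R S) {F : Set (Subalgebra R S)} (hne : F.Nonempty)
    (hsup : ∀ V ∈ F, ∀ W ∈ F, V ⊔ W ∈ F) : ∃ T, IsGreatest F T := by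
  have := h.wellFoundedGT
  obtain ⟨T, hT, hmax⟩ := WellFoundedGT.exists_maximal ‹_› F hne
  exact ⟨T, hT, fun V hV => le_sup_right.trans (hmax (hsup T hT V hV) le_sup_left)⟩

theorem mainTheorem3 (R S : Type*) [CommRing R] [CommRing S] [Algebra R S]
    (hinj : Function.Injective (algebraMap R S))
    (hFCP : IsFCPExtension R S) (hS : IsSemilocal S) :
    ∃ T : Subalgebra R S,
      IsGreatest {V : Subalgebra R S | IsStronglyLocal R V} T ∧
      (T = compositum (slSubextensions R S) ∧
        IsLUB (slSubextensions R S) T ∧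
        (T : Set S) = ⋃ V ∈ slSubextensions R S, (V : Set S)) ∧
      (T = compositum (seminormalInfraIntegralSubextensions R S) ∧
        IsLUB (seminormalInfraIntegralSubextensions R S) T ∧
        (T : Set S) = ⋃ V ∈ seminormalInfraIntegralSubextensions R S, (V : Set S)) := by
  have hinjV : ∀ V : Subalgebra R S, Function.Injective (algebraMap R V) := fun V _ _ hab =>
    hinj (congrArg Subtype.val hab)
  have hbool : ∀ V : Subalgebra R S, IsStronglyLocal R V ↔ IsBooleanModConductor R V := fun V =>
    ⟨fun h => h.isBooleanModConductor (hFCP.isSemilocal hS V), fun h => h.isStronglyLocal (hinjV V)⟩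
  have hF : seminormalInfraIntegralSubextensions R S = slSubextensions R S := by
    ext V
    refine ⟨fun ⟨hs, hi, hres⟩ => hs.isStronglyLocal (hinjV V) (hFCP.subalgebra V) hi hres,
      fun h => ?_⟩
    have hb := (hbool V).mp h
    exact ⟨hb.isSeminormalExtension, hb.isInfraIntegral, hb.nonempty_quotient_ringEquiv⟩
  obtain ⟨T, hT⟩ : ∃ T, IsGreatest (slSubextensions R S) T := by
    refine hFCP.exists_isGreatest ⟨⊥, (hbool ⊥).mpr ?_⟩ fun V hV W hW =>
      (hbool _).mpr (((hbool V).mp hV).sup ((hbool W).mp hW))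
    rw [isBooleanModConductor_iff_forall_mem_bot]
    exact fun v hv w hw => mul_mem (sub_mem (pow_mem hv 2) hv) hw
  have h := IsGreatest.eq_compositum_and_isLUB_and_eq_iUnion hT
  exact ⟨T, hT, h, hF ▸ h⟩
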